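/- Let $A$ be one of the real algebras $\mathbb{C},\mathbb{H},\mathbb{O}$, with conjugation $x\mapsto x^c$ and Euclidean norm $|x|$, so that $x^{-1}=|x|^{-2}x^c$ for $x\neq 0$; let $\operatorname{Im}(x)=\frac12(x-x^c)$ and let $\mathbb{S}=\{J\in A : J+J^c=0,\ JJ^c=1\}$ be the set of imaginary units. The circularization of $E\subseteq\mathbb{C}$ is $\Omega_E=\{\alpha+\beta J : \alpha,\beta\in\mathbb{R},\ J\in\mathbb{S},\ \alpha+i\beta\in E\}$; a subset of $A$ is circular if it equals $\Omega_E$ for some $E$. For $x=\alpha+\beta J$ put $\mathbb{S}_x=\alpha+\beta\,\mathbb{S}$. Let $D\subseteq\mathbb{C}$ be open and invariant under complex conjugation, and let $\Omega=\Omega_D$. A function $f:\Omega\to A$ is slice regular if there are $C^1$ functions $F_1,F_2:D\to A$ with $F_1(\bar z)=F_1(z)$, $F_2(\bar z)=-F_2(z)$, $\partial_\alpha F_1=\partial_\beta F_2$, $\partial_\beta F_1=-\partial_\alpha F_2$ (where $z=\alpha+i\beta$), such that $f(\alpha+\beta J)=F_1(\alpha+i\beta)+J\,F_2(\alpha+i\beta)$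 for all $\alpha+i\beta\in D$ and $J\in\mathbb{S}$. The set $\Omega$ is a slice domain if $D$ is connected and intersects $\mathbb{R}$; it is a product domain if $D$ does not intersect $\mathbb{R}$ and has exactly two connected components, switched by complex conjugation. For $J\in\mathbb{S}$ let $\Omega_J^+=\Omega\cap\{\alpha+\beta J:\alpha\in\mathbb{R},\ \beta>0\}$. For a slice regular $f$ on $\Omega$ put $f^\circ_s(x)=\frac12(f(x)+f(x^c))$ for $x\in\Omega$, and $f'_s(x)=\frac12\operatorname{Im}(x)^{-1}(f(x)-f(x^c))$ for $x\in\Omega\setminus\mathbb{R}$. Let $V(f'_s)$ be the zero set of $f'_s$ in $\Omega\setminus\mathbb{R}$ and $\partial V(f'_s)$ its closure minus its interior. For $x\in\Omega\setminus\mathbb{R}$ let $f^c(x)=f^\circ_s(x)^c+\operatorname{Im}(x)f'_s(x)^c$ and let $N(f)=f\cdot f^c$, where the slice product is $f\cdot g=f^\circ_s\,g^\circ_s+\operatorname{Im}(x)^2 f'_s\,g'_s+\operatorname{Im}(x)\,(f^\circ_s\,g'_s+f'_s\,g^\circ_s)$. On $\Omega''=\{x\in\Omega\setminus\mathbb{R}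 : N(f)(x)\neq0,\ f'_s(x)\neq 0\}$ let $$T_f(x)=\big(f^c(x)^{-1}\big((x f^c(x))f'_s(x)\big)\big)f'_s(x)^{-1}.$$ **Theorem (Minimum modulus principle).** Let $f$ be slice regular on $\Omega$, and suppose that $x_0\in\Omega$ is a local minimum point for $|f|$ with $f(x_0)\neq 0$. If $x_0\in\partial V(f'_s)$, assume moreover that at least one of the following holds: (a) there is a circular neighbourhood $C\subseteq\Omega$ of $x_0$ such that $|f(x_0)|=\min_C|f|$; (b) there are $w_0\in\mathbb{S}_{x_0}$ and an open neighbourhood $H$ of $w_0$ in $\Omega$ such that $T_f$ extends to a continuous map $T:\Omega''\cup H\to A$ with $T(w_0)=x_0$. If $\Omega$ is a slice domain, then $f$ is constant. If $\Omega$ is a product domain, then there exists $J\in\mathbb{S}$ such that $f\equiv f(x_0)$ on $\Omega_J^+$. -/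

import Mathlib

open scoped Quaternion Topology ComplexConjugate

noncomputable section

/-- The real algebra `𝕆 = ℍ + ℓ ℍ` of octonions. The pair `(a, b)` stands for `a + ℓ b`; the norm is
the Euclidean one, `‖a + ℓ b‖² = ‖a‖² + ‖b‖²`. -/
def Octonion : Type := WithLp 2 (ℍ × ℍ)

namespace Octonion

instance : NormedAddCommGroup Octonion := inferInstanceAs (NormedAddCommGroup (WithLp 2 (ℍ × ℍ)))

instance : InnerProductSpace ℝ Octonion := inferInstanceAs (InnerProductSpace ℝ (WithLp 2 (ℍ × ℍ)))

/-- The octonion `a + ℓ b`. -/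
def mk (a b : ℍ) : Octonion := WithLp.toLp 2 (a, b)

/-- The component `a` of `a + ℓ b`. -/
def fst (x : Octonion) : ℍ := (WithLp.ofLp x).1

/-- The component `b` of `a + ℓ b`. -/
def snd (x : Octonion) : ℍ := (WithLp.ofLp x).2

instance : One Octonion := ⟨mk 1 0⟩

/-- `(α + ℓ β)(γ + ℓ δ) = αγ - δ βᶜ + ℓ (αᶜ δ + γ β)`. -/
instance : Mul Octonion :=
  ⟨fun x y => mk (x.fst * y.fst - y.snd * star x.snd) (star x.fst * y.snd + y.fst * x.snd)⟩

/-- `(α + ℓ β)ᶜ = αᶜ - ℓ β`. -/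
instance : Star Octonion := ⟨fun x => mk (star x.fst) (-x.snd)⟩

end Octonion

/-- The three algebras `ℂ`, `ℍ`, `𝕆`. -/
inductive BaseAlgebra : Type
  | complex
  | quaternion
  | octonion

namespace BaseAlgebra

/-- The underlying type of each of the three algebras. -/
def Carrier : BaseAlgebra → Type
  | complex => ℂ
  | quaternion => ℍ
  | octonion => Octonion

instance : CoeSort BaseAlgebra Type := ⟨Carrier⟩

instance instNormedAddCommGroup : (A : BaseAlgebra) → NormedAddCommGroup A
  | complex => inferInstanceAs (NormedAddCommGroup ℂ)
  | quaternion => inferInstanceAs (NormedAddCommGroup ℍ)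
  | octonion => inferInstanceAs (NormedAddCommGroup Octonion)

instance instInnerProductSpace : (A : BaseAlgebra) → InnerProductSpace ℝ A
  | complex => inferInstanceAs (InnerProductSpace ℝ ℂ)
  | quaternion => inferInstanceAs (InnerProductSpace ℝ ℍ)
  | octonion => inferInstanceAs (InnerProductSpace ℝ Octonion)

instance instMul : (A : BaseAlgebra) → Mul A
  | complex => inferInstanceAs (Mul ℂ)
  | quaternion => inferInstanceAs (Mul ℍ)
  | octonion => inferInstanceAs (Mul Octonion)

instance instOne : (A : BaseAlgebra) → One A
  | complex => inferInstanceAs (One ℂ)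
  | quaternion => inferInstanceAs (One ℍ)
  | octonion => inferInstanceAs (One Octonion)

/-- The conjugation `x ↦ xᶜ`. -/
instance instStar : (A : BaseAlgebra) → Star A
  | complex => inferInstanceAs (Star ℂ)
  | quaternion => inferInstanceAs (Star ℍ)
  | octonion => inferInstanceAs (Star Octonion)

end BaseAlgebra

namespace SliceFunction

variable {A : BaseAlgebra}

/-- The inverse `x⁻¹ = n(x)⁻¹ xᶜ`, where `n(x) = ‖x‖²` (and `0` for `x = 0`). -/
def inv (x : A) : A := (‖x‖ ^ 2)⁻¹ • star x

/-- The imaginary part `(x - xᶜ) / 2`. -/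
def imPart (x : A) : A := (2⁻¹ : ℝ) • (x - star x)

/-- The real line inside `A`. -/
def realLine (A : BaseAlgebra) : Set A := {x | ∃ r : ℝ, x = r • (1 : A)}

/-- The sphere of imaginary units: trace zero and norm one. -/
def imUnits (A : BaseAlgebra) : Set A := {J | J + star J = 0 ∧ J * star J = 1}

/-- The element `α + β J` of `A`. -/
def point (α β : ℝ) (J : A) : A := α • (1 : A) + β • J

/-- The circularization `Ω_E` of `E ⊆ ℂ` in `A`. -/
def circularization (A : BaseAlgebra) (E : Set ℂ) : Set A :=
  {x | ∃ α β : ℝ, ∃ J ∈ imUnits A, x = point α β J ∧ (⟨α, β⟩ : ℂ) ∈ E}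

/-- Circular subsets of `A`. -/
def IsCircular (C : Set A) : Prop := ∃ E : Set ℂ, C = circularization A E

/-- The sphere `𝕊_x = α + β 𝕊` through `x = α + β J`. -/
def sphereThrough (x : A) : Set A :=
  {y | ∃ α β : ℝ, ∃ J ∈ imUnits A, ∃ I ∈ imUnits A, x = point α β J ∧ y = point α β I}

/-- The open half-plane `ℂ_J⁺ = {α + β J | β > 0}`. -/
def halfPlane (J : A) : Set A := {x | ∃ α β : ℝ, 0 < β ∧ x = point α β J}

/-- Invariance of `D ⊆ ℂ` under complex conjugation. -/
def ConjInvariant (D : Set ℂ) : Prop := ∀ z ∈ D, conj z ∈ D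

/-- `Ω_D` is a slice domain: `D` is open, connected and intersects the real line. -/
def IsSliceDomain (D : Set ℂ) : Prop :=
  IsOpen D ∧ IsConnected D ∧ ∃ r : ℝ, (r : ℂ) ∈ D

/-- `Ω_D` is a product domain: `D` is open, does not intersect the real line and has exactly two
connected components, which are switched by complex conjugation. -/
def IsProductDomain (D : Set ℂ) : Prop :=
  IsOpen D ∧ (∀ r : ℝ, (r : ℂ) ∉ D) ∧
    ∃ D₁ D₂ : Set ℂ, D₁ ≠ D₂ ∧ {E | ∃ z ∈ D, E = connectedComponentIn D z} = {D₁, D₂} ∧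
      (fun z : ℂ => conj z) '' D₁ = D₂

/-- `F₁ + ι F₂ : D → A ⊗ ℂ` is a stem function inducing `f`, i.e. `F₁` is even and `F₂` is odd with
respect to complex conjugation, and `f (α + β J) = F₁ (α + i β) + J F₂ (α + i β)` for all imaginary
units `J`. -/
structure IsInducedBy (D : Set ℂ) (F₁ F₂ : ℂ → A) (f : A → A) : Prop where
  even : ∀ z ∈ D, F₁ (conj z) = F₁ z
  odd : ∀ z ∈ D, F₂ (conj z) = -F₂ z
  induces : ∀ α β : ℝ, (⟨α, β⟩ : ℂ) ∈ D → ∀ J ∈ imUnits A,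
    f (point α β J) = F₁ ⟨α, β⟩ + J * F₂ ⟨α, β⟩

/-- `f ∈ 𝒮ℛ(Ω_D)`: `D` is open and `f` is induced on `Ω_D` by a stem function `F₁ + ι F₂` of class
`C¹` which is holomorphic, `∂F₁/∂α = ∂F₂/∂β` and `∂F₁/∂β = -∂F₂/∂α`. Values of `f` outside
`Ω_D` are irrelevant. -/
def IsSliceRegular (D : Set ℂ) (f : A → A) : Prop :=
  IsOpen D ∧ ∃ F₁ F₂ : ℂ → A, IsInducedBy D F₁ F₂ f ∧
    ContDiffOn ℝ 1 F₁ D ∧ ContDiffOn ℝ 1 F₂ D ∧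
    ∀ z ∈ D, fderiv ℝ F₁ z 1 = fderiv ℝ F₂ z Complex.I ∧
      fderiv ℝ F₁ z Complex.I = -fderiv ℝ F₂ z 1

/-- The spherical value of `f`. -/
def sphValue (f : A → A) (x : A) : A := (2⁻¹ : ℝ) • (f x + f (star x))

/-- The spherical derivative of `f` (meaningful for `x ∉ ℝ`). -/
def sphDeriv (f : A → A) (x : A) : A := (2⁻¹ : ℝ) • (inv (imPart x) * (f x - f (star x)))

/-- The slice conjugate `fᶜ` of a slice function; at real points, `im x = 0` and the value is
`f(x)ᶜ`. -/
def sliceConj (f : A → A) (x : A) : A := star (sphValue f x) + imPart x * star (sphDeriv f x)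

/-- The slice product `f · g` of slice functions; at real points, `im x = 0` and the value is
`f(x) g(x)`. -/
def sliceMul (f g : A → A) (x : A) : A :=
  (sphValue f x * sphValue g x + (imPart x * imPart x) * (sphDeriv f x * sphDeriv g x)) +
    imPart x * (sphValue f x * sphDeriv g x + sphDeriv f x * sphValue g x)

/-- The normal function `N(f) = f · fᶜ`. -/
def normalFunction (f : A → A) : A → A := sliceMul f (sliceConj f)

/-- The zero set `V(f'_s) ⊆ Ω_D \ ℝ` of the spherical derivative. -/
def sphDerivZeros (D : Set ℂ) (f : A → A) : Set A :=
  {x | x ∈ circularization A D ∧ x ∉ realLine A ∧ sphDeriv f x = 0}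

/-- The domain `Ω'' = (Ω_D \ V(N(f))) \ (ℝ ∪ V(f'_s))` of the transformation `T_f`. -/
def transformDomain (D : Set ℂ) (f : A → A) : Set A :=
  {x | x ∈ circularization A D ∧ normalFunction f x ≠ 0 ∧ x ∉ realLine A ∧ sphDeriv f x ≠ 0}

/-- The transformation
`T_f(x) = (fᶜ(x)⁻¹ ((x fᶜ(x)) f'_s(x))) f'_s(x)⁻¹`. -/
def transform (f : A → A) (x : A) : A :=
  (inv (sliceConj f x) * ((x * sliceConj f x) * sphDeriv f x)) * inv (sphDeriv f x)

end SliceFunction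

end

open SliceFunction

/-! Write `f = F₁ + J F₂`. For fixed `z` the squared modulus is affine in the imaginary unit: `|F₁ +
J F₂|² = p + 2⟨w, J⟩` with `p = |F₁|² + |F₂|²` and `w = Im(F₁ F₂ᶜ)`. The scalar function `n = |F₁|²
- |F₂|² + 2i⟨F₁, F₂⟩` is holomorphic and `|n|² = p² - 4|w|²`. Left multiplication by a unit `J` is
an isometry of square `-1`, so it makes the algebra a complex normed space in which `F₁ + J F₂` is
holomorphic. No associativity is needed, only the alternative laws.

Let the minimum be at `(z₀, J₀)`, with squared value `m`, and let the sphere of units have positive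
dimension. A conformal map of the sphere (`antipodalBoost`) gives a unit `T(z)` with `|F₁ + T F₂|²
|F₁ - J₀ F₂|² = |n|²`. Minimality in `J` makes `w(z₀)` a nonpositive multiple of `J₀`, whence `T(z)
→ J₀` as `z → z₀`. Minimality at `(z, T(z))` then says that `|F₁ - J₀ F₂| / |n|` has a local maximum
at `z₀`. By the maximum principle it is locally constant, so `|F₁ + T F₂|² = m` near `z₀`. Now
`T(z)` is itself a local minimum on the sphere, so `w(z)` is a nonpositive multiple of `T(z)`, and
this forces `|F₁ + J₀ F₂|² = m` (`eventually_affine_family`, `eventually_norm_eq_of_localMin`).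

A holomorphic function of locally constant modulus is locally constant here, again by the maximum
principle, and the identity principle spreads this over the component of `z₀`. Over `ℂ` the sphere
of units is `{±i}` and the classical minimum principle applies. -/

namespace Octonion

/-! ### Coordinates in the octonions and the quaternions. -/

theorem ext {x y : Octonion} (h₁ : x.fst = y.fst) (h₂ : x.snd = y.snd) : x = y :=
  (WithLp.ofLp_injective 2) (Prod.ext h₁ h₂)

theorem fst_mk (a b : ℍ) : (mk a b).fst = a := rfl
theorem snd_mk (a b : ℍ) : (mk a b).snd = b := rfl
theorem fst_add (x y : Octonion) : (x + y).fst = x.fst + y.fst := rfl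
theorem snd_add (x y : Octonion) : (x + y).snd = x.snd + y.snd := rfl
theorem fst_sub (x y : Octonion) : (x - y).fst = x.fst - y.fst := rfl
theorem snd_sub (x y : Octonion) : (x - y).snd = x.snd - y.snd := rfl
theorem fst_smul (r : ℝ) (x : Octonion) : (r • x).fst = r • x.fst := rfl
theorem snd_smul (r : ℝ) (x : Octonion) : (r • x).snd = r • x.snd := rfl
theorem fst_one : (1 : Octonion).fst = 1 := rfl
theorem snd_one : (1 : Octonion).snd = 0 := rfl
theorem fst_star (x : Octonion) : (star x).fst = star x.fst := rfl
theorem snd_star (x : Octonion) : (star x).snd = -x.snd := rfl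
theorem fst_mul (x y : Octonion) :
    (x * y).fst = x.fst * y.fst - y.snd * star x.snd := rfl
theorem snd_mul (x y : Octonion) :
    (x * y).snd = star x.fst * y.snd + y.fst * x.snd := rfl
theorem inner_eq (x y : Octonion) :
    inner ℝ x y = inner ℝ x.fst y.fst + inner ℝ x.snd y.snd := rfl

theorem norm_sq_eq (x : Octonion) : ‖x‖ ^ 2 = ‖x.fst‖ ^ 2 + ‖x.snd‖ ^ 2 := by
  rw [← real_inner_self_eq_norm_sq, ← real_inner_self_eq_norm_sq, ← real_inner_self_eq_norm_sq,
    inner_eq]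

end Octonion

theorem Quaternion.norm_sq_eq (x : ℍ) :
    ‖x‖ ^ 2 = x.re ^ 2 + x.imI ^ 2 + x.imJ ^ 2 + x.imK ^ 2 := by
  rw [sq, ← Quaternion.normSq_eq_norm_mul_self, Quaternion.normSq_def']

theorem Quaternion.inner_eq (x y : ℍ) :
    inner ℝ x y = x.re * y.re + x.imI * y.imI + x.imJ * y.imJ + x.imK * y.imK := by
  simp [Quaternion.inner_def]

theorem Quaternion.exists_coords (a b c d : ℝ) :
    ∃ q : ℍ, q.re = a ∧ q.imI = b ∧ q.imJ = c ∧ q.imK = d :=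
  ⟨⟨a, b, c, d⟩, rfl, rfl, rfl, rfl⟩

theorem Quaternion.exists_orthonormal_imaginary : ∃ e₁ e₂ : ℍ,
    ‖e₁‖ = 1 ∧ ‖e₂‖ = 1 ∧ inner ℝ e₁ 1 = (0 : ℝ) ∧ inner ℝ e₂ 1 = (0 : ℝ) ∧
      inner ℝ e₁ e₂ = (0 : ℝ) := by
  have hn (x : ℍ) (h : ‖x‖ ^ 2 = 1) : ‖x‖ = 1 :=
    (pow_eq_one_iff_of_nonneg (norm_nonneg x) two_ne_zero).1 h
  obtain ⟨e₁, h₀, h₁, h₂, h₃⟩ := exists_coords 0 1 0 0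
  obtain ⟨e₂, k₀, k₁, k₂, k₃⟩ := exists_coords 0 0 1 0
  refine ⟨e₁, e₂, hn _ ?_, hn _ ?_, ?_, ?_, ?_⟩ <;>
    simp [norm_sq_eq, inner_eq, h₀, h₁, h₂, h₃, k₀, k₁, k₂, k₃]

/-! ### Identities common to the three algebras. -/

namespace BaseAlgebra

theorem mul_add_distrib : ∀ {A : BaseAlgebra} (x y z : A), x * (y + z) = x * y + x * z
  | complex, x, y, z => _root_.mul_add (R := ℂ) x y z
  | quaternion, x, y, z => _root_.mul_add (R := ℍ) x y z
  | octonion, x, y, z => by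
    change Octonion at x y z
    change x * (y + z) = x * y + x * z
    refine Octonion.ext ?_ ?_ <;>
      simp only [Octonion.fst_mul, Octonion.snd_mul, Octonion.fst_add, Octonion.snd_add] <;>
      noncomm_ring

theorem add_mul_distrib : ∀ {A : BaseAlgebra} (x y z : A), (x + y) * z = x * z + y * z
  | complex, x, y, z => _root_.add_mul (R := ℂ) x y z
  | quaternion, x, y, z => _root_.add_mul (R := ℍ) x y z
  | octonion, x, y, z => by
    change Octonion at x y z
    change (x + y) * z = x * z + y * z
    refine Octonion.ext ?_ ?_ <;>
      simp only [Octonion.fst_mul, Octonion.snd_mul, Octonion.fst_add, Octonion.snd_add,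
        star_add] <;>
      noncomm_ring

theorem mul_smul_eq : ∀ {A : BaseAlgebra} (r : ℝ) (x y : A), x * (r • y) = r • (x * y)
  | complex, r, x, y => by
    change ℂ at x y
    exact mul_smul_comm r x y
  | quaternion, r, x, y => by
    change ℍ at x y
    exact mul_smul_comm r x y
  | octonion, r, x, y => by
    change Octonion at x y
    change x * (r • y) = r • (x * y)
    refine Octonion.ext ?_ ?_ <;>
      simp only [Octonion.fst_mul, Octonion.snd_mul, Octonion.fst_smul, Octonion.snd_smul,
        mul_smul_comm, smul_mul_assoc, smul_sub, smul_add]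

theorem smul_mul_eq : ∀ {A : BaseAlgebra} (r : ℝ) (x y : A), (r • x) * y = r • (x * y)
  | complex, r, x, y => by
    change ℂ at x y
    exact smul_mul_assoc r x y
  | quaternion, r, x, y => by
    change ℍ at x y
    exact smul_mul_assoc r x y
  | octonion, r, x, y => by
    change Octonion at x y
    change (r • x) * y = r • (x * y)
    refine Octonion.ext ?_ ?_ <;>
      simp [Octonion.fst_mul, Octonion.snd_mul, Octonion.fst_smul, Octonion.snd_smul,
        smul_sub, smul_add]

theorem one_mul_eq : ∀ {A : BaseAlgebra} (x : A), 1 * x = x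
  | complex, x => _root_.one_mul (M := ℂ) x
  | quaternion, x => _root_.one_mul (M := ℍ) x
  | octonion, x => by
    change Octonion at x
    change 1 * x = x
    refine Octonion.ext ?_ ?_ <;>
      simp [Octonion.fst_mul, Octonion.snd_mul, Octonion.fst_one, Octonion.snd_one]

/-- Conjugation is the reflection in the real line. This reduces conjugates, imaginary parts and
imaginary units to the inner product with `1`, uniformly in the algebra. -/
theorem star_eq : ∀ {A : BaseAlgebra} (x : A), star x = (2 * inner ℝ x 1) • (1 : A) - x
  | complex, x => by
    change ℂ at x
    change star x = (2 * inner ℝ x 1) • (1 : ℂ) - x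
    apply Complex.ext <;> simp
    ring
  | quaternion, x => by
    change ℍ at x
    change star x = (2 * inner ℝ x 1) • (1 : ℍ) - x
    apply Quaternion.ext <;> simp [Quaternion.inner_eq]
    ring
  | octonion, x => by
    change Octonion at x
    change star x = (2 * inner ℝ x 1) • (1 : Octonion) - x
    refine Octonion.ext ?_ ?_
    · apply Quaternion.ext <;>
        simp [Octonion.inner_eq, Quaternion.inner_eq, Octonion.fst_star, Octonion.fst_sub,
          Octonion.fst_smul, Octonion.fst_one, Octonion.snd_one]
      ring
    · simp [Octonion.snd_star, Octonion.snd_sub, Octonion.snd_smul, Octonion.snd_one]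

theorem norm_one_eq : ∀ {A : BaseAlgebra}, ‖(1 : A)‖ = 1
  | complex => CStarRing.norm_one (E := ℂ)
  | quaternion => NormOneClass.norm_one (α := ℍ)
  | octonion => by
    have h := Octonion.norm_sq_eq 1
    rw [Octonion.fst_one, Octonion.snd_one] at h
    refine (pow_eq_one_iff_of_nonneg (norm_nonneg (1 : Octonion)) two_ne_zero).1 (h.trans ?_)
    simp

theorem inner_mul_right_eq : ∀ {A : BaseAlgebra} (x y z : A),
    inner ℝ x (y * z) = inner ℝ (x * star z) y
  | complex, x, y, z => by
    change ℂ at x y z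
    change inner ℝ x (y * z) = inner ℝ (x * star z) y
    simp [Complex.inner]; ring
  | quaternion, x, y, z => by
    change ℍ at x y z
    change inner ℝ x (y * z) = inner ℝ (x * star z) y
    simp [Quaternion.inner_eq]; ring
  | octonion, x, y, z => by
    change Octonion at x y z
    change inner ℝ x (y * z) = inner ℝ (x * star z) y
    simp [Octonion.inner_eq, Quaternion.inner_eq, Octonion.fst_mul, Octonion.snd_mul,
      Octonion.fst_star, Octonion.snd_star]
    ring

/-- A form of right alternativity, standing in for associativity. With the adjoint formula
`inner_mul_right_eq` it makes the norm multiplicative. -/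
theorem mul_mul_star_eq : ∀ {A : BaseAlgebra} (x y : A), (x * y) * star y = ‖y‖ ^ 2 • x
  | complex, x, y => by
    change ℂ at x y
    change (x * y) * star y = ‖y‖ ^ 2 • x
    rw [← Complex.normSq_eq_norm_sq]
    apply Complex.ext <;> simp [Complex.normSq_apply] <;> ring
  | quaternion, x, y => by
    change ℍ at x y
    change (x * y) * star y = ‖y‖ ^ 2 • x
    apply Quaternion.ext <;> simp [Quaternion.norm_sq_eq] <;> ring
  | octonion, x, y => by
    change Octonion at x y
    change (x * y) * star y = ‖y‖ ^ 2 • x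
    refine Octonion.ext ?_ ?_ <;> apply Quaternion.ext <;>
      simp [Octonion.norm_sq_eq, Quaternion.norm_sq_eq, Octonion.fst_mul, Octonion.snd_mul,
        Octonion.fst_star, Octonion.snd_star, Octonion.fst_smul, Octonion.snd_smul] <;> ring

/-- The left counterpart; for an imaginary unit it reads `J (J y) = -y`, the source of the complex
structures. -/
theorem star_mul_mul_eq : ∀ {A : BaseAlgebra} (x y : A), star x * (x * y) = ‖x‖ ^ 2 • y
  | complex, x, y => by
    change ℂ at x y
    change star x * (x * y) = ‖x‖ ^ 2 • y
    rw [← Complex.normSq_eq_norm_sq]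
    apply Complex.ext <;> simp [Complex.normSq_apply] <;> ring
  | quaternion, x, y => by
    change ℍ at x y
    change star x * (x * y) = ‖x‖ ^ 2 • y
    apply Quaternion.ext <;> simp [Quaternion.norm_sq_eq] <;> ring
  | octonion, x, y => by
    change Octonion at x y
    change star x * (x * y) = ‖x‖ ^ 2 • y
    refine Octonion.ext ?_ ?_ <;> apply Quaternion.ext <;>
      simp [Octonion.norm_sq_eq, Quaternion.norm_sq_eq, Octonion.fst_mul, Octonion.snd_mul,
        Octonion.fst_star, Octonion.snd_star, Octonion.fst_smul, Octonion.snd_smul] <;> ring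

/-- Outside `ℂ` the imaginary part has dimension at least two. -/
theorem exists_orthonormal_imaginary : ∀ {A : BaseAlgebra}, A ≠ complex → ∃ e₁ e₂ : A,
    ‖e₁‖ = 1 ∧ ‖e₂‖ = 1 ∧ inner ℝ e₁ 1 = (0 : ℝ) ∧ inner ℝ e₂ 1 = (0 : ℝ) ∧ inner ℝ e₁ e₂ = (0 : ℝ)
  | complex, h => (h rfl).elim
  | quaternion, _ => Quaternion.exists_orthonormal_imaginary
  | octonion, _ => by
    have hn (x : Octonion) (h : ‖x‖ ^ 2 = 1) : ‖x‖ = 1 :=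
      (pow_eq_one_iff_of_nonneg (norm_nonneg x) two_ne_zero).1 h
    obtain ⟨e₁, e₂, h₁, h₂, h₃, h₄, h₅⟩ := Quaternion.exists_orthonormal_imaginary
    refine ⟨Octonion.mk e₁ 0, Octonion.mk e₂ 0, hn _ ?_, hn _ ?_,
      (Octonion.inner_eq _ 1).trans ?_, (Octonion.inner_eq _ 1).trans ?_,
      (Octonion.inner_eq _ _).trans ?_⟩ <;>
      simp [Octonion.norm_sq_eq, Octonion.fst_mk, Octonion.snd_mk, Octonion.fst_one, h₁, h₂, h₃,
        h₄, h₅]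

instance instCompleteSpace : (A : BaseAlgebra) → CompleteSpace A
  | complex => inferInstanceAs (CompleteSpace ℂ)
  | quaternion => inferInstanceAs (CompleteSpace ℍ)
  | octonion => inferInstanceAs (CompleteSpace (WithLp 2 (ℍ × ℍ)))

end BaseAlgebra

/-! ### Holomorphic functions with respect to an orthogonal complex structure. -/

/-- A real differentiable map satisfying the Cauchy–Riemann equation is complex differentiable. -/
theorem differentiableAt_complex_of_cauchyRiemann {E : Type*} [NormedAddCommGroup E]
    [NormedSpace ℝ E] [NormedSpace ℂ E] [IsScalarTower ℝ ℂ E] {h : ℂ → E} {z : ℂ}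
    (hd : DifferentiableAt ℝ h z)
    (hCR : fderiv ℝ h z Complex.I = Complex.I • fderiv ℝ h z 1) : DifferentiableAt ℂ h z := by
  have key : ((1 : ℂ →L[ℂ] ℂ).smulRight (fderiv ℝ h z 1)).restrictScalars ℝ = fderiv ℝ h z := by
    ext w
    have hw : w = w.re • (1 : ℂ) + w.im • Complex.I := by
      apply Complex.ext <;> simp
    have e (r : ℝ) (x : E) : (r : ℂ) • x = r • x := by
      rw [← Complex.coe_algebraMap, algebraMap_smul]
    conv_rhs => rw [hw, map_add, map_smul, map_smul, hCR]
    have : w • fderiv ℝ h z 1 =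
        w.re • fderiv ℝ h z 1 + w.im • Complex.I • fderiv ℝ h z 1 := by
      conv_lhs => rw [← Complex.re_add_im w, add_smul, mul_smul, e, e]
    simpa using this
  exact (hasFDerivAt_of_restrictScalars ℝ hd.hasFDerivAt key).differentiableAt

section ComplexStructure

variable {E : Type*} [NormedAddCommGroup E] [InnerProductSpace ℝ E]

/-- The complex vector space structure in which `i` acts as a map of square `-1`. -/
abbrev moduleOfComplexStructure (L : E →ₗ[ℝ] E) (hL : ∀ x, L (L x) = -x) : Module ℂ E where
  smul z x := z.re • x + z.im • L x
  one_smul x := by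
    change (1 : ℂ).re • x + (1 : ℂ).im • L x = x
    simp
  mul_smul z w x := by
    change (z * w).re • x + (z * w).im • L x =
      z.re • (w.re • x + w.im • L x) + z.im • L (w.re • x + w.im • L x)
    simp only [Complex.mul_re, Complex.mul_im, map_add, map_smul, hL]
    module
  smul_zero z := by
    change z.re • (0 : E) + z.im • L 0 = 0
    simp
  smul_add z x y := by
    change z.re • (x + y) + z.im • L (x + y) = (z.re • x + z.im • L x) + (z.re • y + z.im • L y)
    rw [map_add]
    module
  add_smul z w x := by
    change (z + w).re • x + (z + w).im • L x = (z.re • x + z.im • L x) + (w.re • x + w.im • L x)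
    rw [Complex.add_re, Complex.add_im]
    module
  zero_smul x := by
    change (0 : ℂ).re • x + (0 : ℂ).im • L x = 0
    simp

theorem norm_sq_smul_add_smul {L : E →ₗ[ℝ] E} (hn : ∀ x, ‖L x‖ = ‖x‖)
    (ho : ∀ x, inner ℝ x (L x) = (0 : ℝ)) (a b : ℝ) (x : E) :
    ‖a • x + b • L x‖ ^ 2 = (a ^ 2 + b ^ 2) * ‖x‖ ^ 2 := by
  rw [norm_add_sq_real, inner_smul_left, inner_smul_right, ho, norm_smul, norm_smul, hn, mul_pow,
    mul_pow, Real.norm_eq_abs, Real.norm_eq_abs, sq_abs, sq_abs]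
  simp
  ring

/-- The complex normed space structure defined by an isometry `L` of square `-1` with
`L x ⊥ x`. -/
abbrev normedSpaceOfComplexStructure (L : E →ₗ[ℝ] E) (hL : ∀ x, L (L x) = -x)
    (hn : ∀ x, ‖L x‖ = ‖x‖) (ho : ∀ x, inner ℝ x (L x) = (0 : ℝ)) : NormedSpace ℂ E :=
  { moduleOfComplexStructure L hL with
    norm_smul_le := fun z x => by
      change ‖z.re • x + z.im • L x‖ ≤ ‖z‖ * ‖x‖
      refine (sq_le_sq₀ (norm_nonneg _) (by positivity)).1 ?_
      rw [norm_sq_smul_add_smul hn ho, mul_pow, Complex.sq_norm, Complex.normSq_apply]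
      exact le_of_eq (by ring) }

theorem isScalarTower_complexStructure (L : E →ₗ[ℝ] E) (hL : ∀ x, L (L x) = -x)
    (hn : ∀ x, ‖L x‖ = ‖x‖) (ho : ∀ x, inner ℝ x (L x) = (0 : ℝ)) :
    let _ := normedSpaceOfComplexStructure L hL hn ho
    IsScalarTower ℝ ℂ E :=
  let _ := normedSpaceOfComplexStructure L hL hn ho
  ⟨fun r z x => by
    change (r • z).re • x + (r • z).im • L x = r • (z.re • x + z.im • L x)
    rw [Complex.smul_re, Complex.smul_im, smul_add, smul_assoc, smul_assoc]⟩

theorem I_smul_complexStructure (L : E →ₗ[ℝ] E) (hL : ∀ x, L (L x) = -x)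
    (hn : ∀ x, ‖L x‖ = ‖x‖) (ho : ∀ x, inner ℝ x (L x) = (0 : ℝ)) (x : E) :
    let _ := normedSpaceOfComplexStructure L hL hn ho
    Complex.I • x = L x := by
  change Complex.I.re • x + Complex.I.im • L x = L x
  simp

/-- Local maximum modulus principle for the product of a holomorphic scalar function and a
vector-valued function holomorphic with respect to the complex structure `L`. -/
theorem eventually_norm_mul_norm_eq_of_isLocalMax {L : E →ₗ[ℝ] E} (hL : ∀ x, L (L x) = -x)
    (hn : ∀ x, ‖L x‖ = ‖x‖) (ho : ∀ x, inner ℝ x (L x) = (0 : ℝ)) {h : ℂ → E} {n : ℂ → ℂ} {z₀ : ℂ}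
    (hd : ∀ᶠ z in 𝓝 z₀, DifferentiableAt ℝ h z)
    (hCR : ∀ᶠ z in 𝓝 z₀, fderiv ℝ h z Complex.I = L (fderiv ℝ h z 1))
    (hnd : ∀ᶠ z in 𝓝 z₀, DifferentiableAt ℂ n z)
    (hmax : IsLocalMax (fun z => ‖n z‖ * ‖h z‖) z₀) :
    ∀ᶠ z in 𝓝 z₀, ‖n z‖ * ‖h z‖ = ‖n z₀‖ * ‖h z₀‖ := by
  let _ := normedSpaceOfComplexStructure L hL hn ho
  have := isScalarTower_complexStructure L hL hn ho
  have key : ∀ᶠ z in 𝓝 z₀, DifferentiableAt ℂ (fun z => n z • h z) z := by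
    filter_upwards [hd, hCR, hnd] with z hz hz' hnz
    refine hnz.smul (differentiableAt_complex_of_cauchyRiemann hz ?_)
    rw [hz']
    exact (I_smul_complexStructure L hL hn ho _).symm
  have := Complex.norm_eventually_eq_of_isLocalMax key (by simpa [Function.comp_def, norm_smul])
  simpa [norm_smul] using this

/-- Local maximum modulus principle for functions holomorphic with respect to `L`. -/
theorem eventually_eq_of_isLocalMax_norm_of_complexStructure {L : E →ₗ[ℝ] E}
    (hL : ∀ x, L (L x) = -x)
    (hn : ∀ x, ‖L x‖ = ‖x‖) (ho : ∀ x, inner ℝ x (L x) = (0 : ℝ)) {h : ℂ → E} {z₀ : ℂ}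
    (hd : ∀ᶠ z in 𝓝 z₀, DifferentiableAt ℝ h z)
    (hCR : ∀ᶠ z in 𝓝 z₀, fderiv ℝ h z Complex.I = L (fderiv ℝ h z 1))
    (hmax : IsLocalMax (fun z => ‖h z‖) z₀) : ∀ᶠ z in 𝓝 z₀, h z = h z₀ := by
  let _ := normedSpaceOfComplexStructure L hL hn ho
  have := isScalarTower_complexStructure L hL hn ho
  refine Complex.eventually_eq_of_isLocalMax_norm ?_ hmax
  filter_upwards [hd, hCR] with z hz hz'
  refine differentiableAt_complex_of_cauchyRiemann hz ?_
  rw [hz']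
  exact (I_smul_complexStructure L hL hn ho _).symm

/-- Identity principle for functions holomorphic with respect to `L`. -/
theorem eqOn_const_of_eventually_eq_of_complexStructure [CompleteSpace E] {L : E →ₗ[ℝ] E}
    (hL : ∀ x, L (L x) = -x)
    (hn : ∀ x, ‖L x‖ = ‖x‖) (ho : ∀ x, inner ℝ x (L x) = (0 : ℝ)) {h : ℂ → E} {U : Set ℂ} {z₀ : ℂ}
    (hU : IsOpen U) (hU' : IsPreconnected U) (hz₀ : z₀ ∈ U)
    (hd : ∀ z ∈ U, DifferentiableAt ℝ h z)
    (hCR : ∀ z ∈ U, fderiv ℝ h z Complex.I = L (fderiv ℝ h z 1)) {c : E}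
    (hc : ∀ᶠ z in 𝓝 z₀, h z = c) : ∀ z ∈ U, h z = c := by
  let _ := normedSpaceOfComplexStructure L hL hn ho
  have := isScalarTower_complexStructure L hL hn ho
  have key : DifferentiableOn ℂ h U := by
    intro z hz
    refine (differentiableAt_complex_of_cauchyRiemann (hd z hz) ?_).differentiableWithinAt
    rw [hCR z hz]
    exact (I_smul_complexStructure L hL hn ho _).symm
  exact (key.analyticOnNhd hU).eqOn_of_preconnected_of_eventuallyEq
    (g := fun _ => c) analyticOnNhd_const hU' hz₀ hc

/-- If `F₁ + ι F₂` is holomorphic, so is its normal function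
`|F₁|² - |F₂|² + 2 i ⟨F₁, F₂⟩`. -/
theorem differentiableAt_normal_of_cauchyRiemann {F₁ F₂ : ℂ → E} {z : ℂ}
    (h₁ : DifferentiableAt ℝ F₁ z) (h₂ : DifferentiableAt ℝ F₂ z)
    (hCR : fderiv ℝ F₁ z 1 = fderiv ℝ F₂ z Complex.I)
    (hCR' : fderiv ℝ F₁ z Complex.I = -fderiv ℝ F₂ z 1) :
    DifferentiableAt ℂ
      (fun z => (⟨‖F₁ z‖ ^ 2 - ‖F₂ z‖ ^ 2, 2 * inner ℝ (F₁ z) (F₂ z)⟩ : ℂ)) z := by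
  -- The function is `⟨Φ, Φ⟩` for `Φ = F₁ + ι F₂` and the complex bilinear extension of the inner
  -- product; `hu` and `hv` differentiate its real and imaginary parts.
  have hu := h₁.hasFDerivAt.norm_sq.sub h₂.hasFDerivAt.norm_sq
  have hv := (h₁.hasFDerivAt.inner ℝ h₂.hasFDerivAt).const_mul 2
  have hw : HasFDerivAt (fun z => (⟨‖F₁ z‖ ^ 2 - ‖F₂ z‖ ^ 2, 2 * inner ℝ (F₁ z) (F₂ z)⟩ : ℂ)) _ z :=
    Complex.equivRealProdCLM.symm.hasFDerivAt.comp z (hu.prodMk hv)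
  refine differentiableAt_complex_iff_differentiableAt_real.2 ⟨hw.differentiableAt, ?_⟩
  rw [hw.fderiv]
  apply Complex.ext <;>
    simp [hCR, hCR', fderivInnerCLM_apply, real_inner_comm] <;> ring

end ComplexStructure

/-- Minimum modulus principle for a function that is holomorphic or antiholomorphic, according to
the choice of `J = ± i`. -/
theorem Complex.eventually_eq_of_isLocalMin_norm_of_unit {h : ℂ → ℂ} {z₀ J : ℂ}
    (hJ : J = Complex.I ∨ J = -Complex.I)
    (hd : ∀ᶠ z in 𝓝 z₀, DifferentiableAt ℝ h z)
    (hCR : ∀ᶠ z in 𝓝 z₀, fderiv ℝ h z Complex.I = J * fderiv ℝ h z 1)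
    (hmin : IsLocalMin (fun z => ‖h z‖) z₀) (h₀ : h z₀ ≠ 0) : ∀ᶠ z in 𝓝 z₀, h z = h z₀ := by
  rcases hJ with rfl | rfl
  · refine (Complex.eventually_eq_or_eq_zero_of_isLocalMin_norm ?_ hmin).resolve_right h₀
    filter_upwards [hd, hCR] with z hz hz'
    exact differentiableAt_complex_iff_differentiableAt_real.2 ⟨hz, hz'⟩
  -- For `J = -i` the function is antiholomorphic, and its conjugate is holomorphic with the same
  -- modulus.
  · have key := (Complex.eventually_eq_or_eq_zero_of_isLocalMin_norm
      (f := fun z => Complex.conjCLE (h z)) (c := z₀) ?_ ?_).resolve_right (by simpa using h₀)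
    · filter_upwards [key] with z hz using Complex.conjCLE.injective hz
    · filter_upwards [hd, hCR] with z hz hz'
      have e := Complex.conjCLE.hasFDerivAt.comp z hz.hasFDerivAt
      refine differentiableAt_complex_iff_differentiableAt_real.2 ⟨e.differentiableAt, ?_⟩
      have e' : fderiv ℝ (fun z => Complex.conjCLE (h z)) z = _ := e.fderiv
      rw [e']
      simp [hz']
    · simpa [Function.comp_def] using hmin

/-! ### Linear functionals and conformal maps on a sphere. -/

section Sphere

variable {E : Type*} [NormedAddCommGroup E] [InnerProductSpace ℝ E]

/-- The unit sphere of the orthogonal complement of `e`. -/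
def orthogonalSphere (e : E) : Set E := {J | ‖J‖ = 1 ∧ inner ℝ J e = (0 : ℝ)}

theorem neg_mem_orthogonalSphere {e J : E} (hJ : J ∈ orthogonalSphere e) :
    -J ∈ orthogonalSphere e := by
  refine ⟨by rw [norm_neg, hJ.1], by rw [inner_neg_left, hJ.2, neg_zero]⟩

theorem great_circle_mem_orthogonalSphere {e J u : E} (hJ : J ∈ orthogonalSphere e)
    (hu : u ∈ orthogonalSphere e) (h : inner ℝ J u = (0 : ℝ)) (t : ℝ) :
    Real.cos t • J + Real.sin t • u ∈ orthogonalSphere e := by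
  constructor
  · refine (pow_eq_one_iff_of_nonneg (norm_nonneg _) two_ne_zero).1 ?_
    rw [norm_add_sq_real, inner_smul_left, inner_smul_right, h, norm_smul, norm_smul, hJ.1, hu.1]
    simp
  · rw [inner_add_left, inner_smul_left, inner_smul_left, hJ.2, hu.2]
    simp

theorem isLocalMin_great_circle {e J u w : E} (hJ : J ∈ orthogonalSphere e)
    (hu : u ∈ orthogonalSphere e) (h : inner ℝ J u = (0 : ℝ))
    (hmin : ∀ᶠ I in 𝓝 J, I ∈ orthogonalSphere e → inner ℝ w J ≤ (inner ℝ w I : ℝ)) :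
    IsLocalMin (fun t : ℝ => Real.cos t * inner ℝ w J + Real.sin t * inner ℝ w u) 0 := by
  have hc : Filter.Tendsto (fun t : ℝ => Real.cos t • J + Real.sin t • u) (𝓝 0) (𝓝 J) := by
    have : Continuous (fun t : ℝ => Real.cos t • J + Real.sin t • u) := by fun_prop
    simpa using this.tendsto 0
  filter_upwards [hc.eventually hmin] with t ht
  have := ht (great_circle_mem_orthogonalSphere hJ hu h t)
  rw [inner_add_right, inner_smul_right, inner_smul_right] at this
  simpa using this

theorem exists_orthogonal_mem_orthogonalSphere {e J e₁ e₂ : E} (h₁ : e₁ ∈ orthogonalSphere e)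
    (h₂ : e₂ ∈ orthogonalSphere e) (h₁₂ : inner ℝ e₁ e₂ = (0 : ℝ)) :
    ∃ u ∈ orthogonalSphere e, inner ℝ J u = (0 : ℝ) := by
  by_cases hJ : inner ℝ J e₁ = (0 : ℝ)
  · exact ⟨e₁, h₁, hJ⟩
  -- The combination of `e₁` and `e₂` orthogonal to `J`.
  · set v : E := (inner ℝ J e₂ : ℝ) • e₁ - (inner ℝ J e₁ : ℝ) • e₂ with hv
    have hve₂ : inner ℝ v e₂ = -(inner ℝ J e₁ : ℝ) := by
      rw [hv, inner_sub_left, inner_smul_left, inner_smul_left, h₁₂, real_inner_self_eq_norm_sq,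
        h₂.1]
      simp
    have hv0 : v ≠ 0 := by
      intro h0
      rw [h0, inner_zero_left] at hve₂
      exact hJ (by linarith)
    refine ⟨‖v‖⁻¹ • v, ⟨norm_smul_inv_norm hv0, ?_⟩, ?_⟩
    · rw [inner_smul_left, hv, inner_sub_left, inner_smul_left, inner_smul_left, h₁.2, h₂.2]
      simp
    · rw [inner_smul_right, hv, inner_sub_right, inner_smul_right, inner_smul_right]
      ring

/-- At a local minimum point `J` of a linear functional on a sphere of positive dimension, the
functional is represented by a nonpositive multiple of `J`. -/
theorem exists_nonpos_smul_of_localMin {e J w e₁ e₂ : E} (h₁ : e₁ ∈ orthogonalSphere e)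
    (h₂ : e₂ ∈ orthogonalSphere e) (h₁₂ : inner ℝ e₁ e₂ = (0 : ℝ))
    (hJ : J ∈ orthogonalSphere e) (hw : inner ℝ w e = (0 : ℝ))
    (hmin : ∀ᶠ I in 𝓝 J, I ∈ orthogonalSphere e → inner ℝ w J ≤ (inner ℝ w I : ℝ)) :
    ∃ κ : ℝ, κ ≤ 0 ∧ w = κ • J := by
  -- The derivative at `t = 0` along the great circle from `J` towards `u` is `⟨w, u⟩`.
  have hzero : ∀ u ∈ orthogonalSphere e, inner ℝ J u = (0 : ℝ) → inner ℝ w u = (0 : ℝ) := by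
    intro u hu hJu
    have hd := ((Real.hasDerivAt_cos 0).mul_const (inner ℝ w J : ℝ)).add
      ((Real.hasDerivAt_sin 0).mul_const (inner ℝ w u : ℝ))
    have := (isLocalMin_great_circle hJ hu hJu hmin).hasDerivAt_eq_zero hd
    simpa using this
  refine ⟨inner ℝ w J, ?_, ?_⟩
  · obtain ⟨u, hu, hJu⟩ := exists_orthogonal_mem_orthogonalSphere (J := J) h₁ h₂ h₁₂
    have hm := isLocalMin_great_circle hJ hu hJu hmin
    rw [hzero u hu hJu] at hm
    -- With `⟨w, u⟩ = 0`, minimality reads `⟨w, J⟩ ≤ cos t ⟨w, J⟩`; any small `t ≠ 0`, where `cos t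
    -- < 1`, gives the sign.
    have hne : ∀ᶠ t : ℝ in 𝓝[≠] 0, Real.cos t < 1 := by
      have : Set.Ioo (-(2 * Real.pi)) (2 * Real.pi) ∈ 𝓝[≠] (0 : ℝ) :=
        mem_nhdsWithin_of_mem_nhds
          (Ioo_mem_nhds (by linarith [Real.pi_pos]) (by linarith [Real.pi_pos]))
      filter_upwards [this, self_mem_nhdsWithin] with t ht ht0
      refine lt_of_le_of_ne (Real.cos_le_one t) fun h => ht0 ?_
      exact (Real.cos_eq_one_iff_of_lt_of_lt ht.1 ht.2).1 h
    obtain ⟨t, ht, ht'⟩ := (hne.and (hm.filter_mono nhdsWithin_le_nhds)).exists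
    simp only [Real.cos_zero, Real.sin_zero, mul_zero, add_zero, one_mul] at ht'
    nlinarith
  · by_contra hne
    -- The part of `w` orthogonal to `J`; once normalized it is an admissible direction, so it is
    -- orthogonal to `w` and hence to itself.
    set v : E := w - (inner ℝ w J : ℝ) • J with hv
    have hv0 : v ≠ 0 := sub_ne_zero.2 hne
    have hvJ : inner ℝ J v = (0 : ℝ) := by
      rw [hv, inner_sub_right, inner_smul_right, real_inner_self_eq_norm_sq, hJ.1,
        real_inner_comm]
      ring
    have hve : inner ℝ v e = (0 : ℝ) := by
      rw [hv, inner_sub_left, inner_smul_left, hw, hJ.2]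
      simp
    have hwv := hzero (‖v‖⁻¹ • v) ⟨norm_smul_inv_norm hv0, by rw [inner_smul_left, hve]; simp⟩
      (by rw [inner_smul_right, hvJ, mul_zero])
    rw [inner_smul_right] at hwv
    have hwv' : inner ℝ w v = (0 : ℝ) :=
      (mul_eq_zero.1 hwv).resolve_left (inv_ne_zero (norm_ne_zero_iff.2 hv0))
    have : inner ℝ v v = (0 : ℝ) := by
      nth_rewrite 1 [hv]
      rw [inner_sub_left, inner_smul_left, hwv', hvJ]
      simp
    exact hv0 (inner_self_eq_zero.1 this)

/-- The antipode of the image of `J` under the conformal transformation of the unit sphere that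
moves points in the direction of `q`, where `‖q‖ < 1`. -/
noncomputable def antipodalBoost (q J : E) : E :=
  -((1 + inner ℝ q J)⁻¹ • (√(1 - ‖q‖ ^ 2) • J +
    (1 + inner ℝ q J / (1 + √(1 - ‖q‖ ^ 2))) • q))

theorem one_add_inner_pos {q J : E} (hq : ‖q‖ < 1) (hJ : ‖J‖ = 1) :
    0 < 1 + (inner ℝ q J : ℝ) := by
  have := abs_real_inner_le_norm q J
  rw [hJ, mul_one] at this
  linarith [(abs_le.1 this).1]

theorem antipodalBoost_mem {e q J : E} (hq : ‖q‖ < 1) (hqe : inner ℝ q e = (0 : ℝ))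
    (hJ : J ∈ orthogonalSphere e) : antipodalBoost q J ∈ orthogonalSphere e := by
  have hc := one_add_inner_pos hq hJ.1
  have hs : √(1 - ‖q‖ ^ 2) ^ 2 = 1 - ‖q‖ ^ 2 :=
    Real.sq_sqrt (by nlinarith [norm_nonneg q])
  have hs0 := Real.sqrt_nonneg (1 - ‖q‖ ^ 2)
  unfold antipodalBoost
  set s := √(1 - ‖q‖ ^ 2)
  set c : ℝ := inner ℝ q J with hcdef
  constructor
  · refine (pow_eq_one_iff_of_nonneg (norm_nonneg _) two_ne_zero).1 ?_
    rw [norm_neg, norm_smul, mul_pow, norm_add_sq_real, inner_smul_left, inner_smul_right,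
      norm_smul, norm_smul, hJ.1, mul_pow, mul_pow, real_inner_comm, ← hcdef,
      Real.norm_eq_abs, Real.norm_eq_abs, Real.norm_eq_abs, sq_abs, sq_abs, sq_abs,
      show ‖q‖ ^ 2 = 1 - s ^ 2 by linarith]
    have : (1 : ℝ) + s ≠ 0 := by positivity
    simp only [conj_trivial]
    field_simp
    ring
  · rw [inner_neg_left, inner_smul_left, inner_add_left, inner_smul_left, inner_smul_left, hJ.2,
      hqe]
    simp

/-- The boosted point has inner product `1 - (1 - ‖q‖²) / (1 + ⟨q, J⟩)` with `q`, and passing to the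
antipode changes the sign. With `q = 2w / p` this yields the point whose value is complementary to
the value at `J`. -/
theorem one_add_inner_antipodalBoost_mul {q J : E} (hq : ‖q‖ < 1) (hJ : ‖J‖ = 1) :
    (1 + inner ℝ q (antipodalBoost q J)) * (1 + inner ℝ q J) = 1 - ‖q‖ ^ 2 := by
  have hc := one_add_inner_pos hq hJ
  have hs : √(1 - ‖q‖ ^ 2) ^ 2 = 1 - ‖q‖ ^ 2 :=
    Real.sq_sqrt (by nlinarith [norm_nonneg q])
  have hs0 := Real.sqrt_nonneg (1 - ‖q‖ ^ 2)
  unfold antipodalBoost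
  set s := √(1 - ‖q‖ ^ 2)
  rw [inner_neg_right, inner_smul_right, inner_add_right, inner_smul_right, inner_smul_right,
    real_inner_self_eq_norm_sq, show ‖q‖ ^ 2 = 1 - s ^ 2 by linarith]
  have : (1 : ℝ) + s ≠ 0 := by positivity
  field_simp
  ring

/-- The formula does not involve the direction `q / ‖q‖`, so `q = 0` is not exceptional. -/
theorem continuousAt_antipodalBoost {q J : E} (hq : ‖q‖ < 1) (hJ : ‖J‖ = 1) :
    ContinuousAt (fun q : E => antipodalBoost q J) q := by
  have hc := (one_add_inner_pos hq hJ).ne'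
  have hs : 1 + √(1 - ‖q‖ ^ 2) ≠ 0 := by positivity
  unfold antipodalBoost
  fun_prop (disch := assumption)

/-- A boost fixes both points of the sphere on its axis, so only the antipodal map acts on `-J`; for
`κ = 0` the boost is the identity. -/
theorem antipodalBoost_smul_neg {J : E} {κ : ℝ} (hJ : ‖J‖ = 1) (hκ : ‖κ • J‖ < 1) :
    antipodalBoost (κ • J) (-J) = J := by
  have hκ' : ‖κ • J‖ ^ 2 = κ ^ 2 := by
    rw [norm_smul, hJ, mul_one, Real.norm_eq_abs, sq_abs]
  have hs : √(1 - κ ^ 2) ^ 2 = 1 - κ ^ 2 :=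
    Real.sq_sqrt (by rw [← hκ']; nlinarith [norm_nonneg (κ • J)])
  have hs0 := Real.sqrt_nonneg (1 - κ ^ 2)
  have hc := one_add_inner_pos (J := -J) hκ (by rwa [norm_neg])
  have hcc : (inner ℝ (κ • J) (-J) : ℝ) = -κ := by
    rw [inner_neg_right, inner_smul_left, real_inner_self_eq_norm_sq, hJ]
    simp
  unfold antipodalBoost
  rw [hcc] at hc ⊢
  rw [hκ']
  set s := √(1 - κ ^ 2)
  have h1 : (1 : ℝ) + s ≠ 0 := by positivity
  have : (1 + -κ)⁻¹ * (s - (1 + -κ / (1 + s)) * κ) = 1 := by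
    field_simp
    linear_combination hs
  calc -((1 + -κ)⁻¹ • (s • -J + (1 + -κ / (1 + s)) • κ • J))
      = ((1 + -κ)⁻¹ * (s - (1 + -κ / (1 + s)) * κ)) • J := by module
    _ = J := by rw [this, one_smul]

/-- Consider squared moduli `p z + 2 ⟨w z, J⟩`, affine in the point `J` of a sphere of positive
dimension, with a positive local minimum `m` at `(z₀, J₀)`. The product of the values at `-J₀` and
at the point where it is complementary is bounded below, and equality forces the value at `J₀` to be
`m`. -/
theorem eventually_affine_family {X : Type*} [TopologicalSpace X] {e J₀ e₁ e₂ : E}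
    (h₁ : e₁ ∈ orthogonalSphere e) (h₂ : e₂ ∈ orthogonalSphere e)
    (h₁₂ : inner ℝ e₁ e₂ = (0 : ℝ)) (hJ₀ : J₀ ∈ orthogonalSphere e)
    {p : X → ℝ} {w : X → E} {z₀ : X} {m : ℝ} (hm : 0 < m)
    (hp : ContinuousAt p z₀) (hw : ContinuousAt w z₀) (hwe : ∀ z, inner ℝ (w z) e = (0 : ℝ))
    (hval : p z₀ + 2 * inner ℝ (w z₀) J₀ = m)
    (hmin : ∀ᶠ x in 𝓝 (z₀, J₀), x.2 ∈ orthogonalSphere e →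
      m ≤ p x.1 + 2 * inner ℝ (w x.1) x.2) :
    (0 < p z₀ ^ 2 - 4 * ‖w z₀‖ ^ 2 ∧
      m * (p z₀ - 2 * inner ℝ (w z₀) J₀) = p z₀ ^ 2 - 4 * ‖w z₀‖ ^ 2) ∧
    ∀ᶠ z in 𝓝 z₀, m * (p z - 2 * inner ℝ (w z) J₀) ≤ p z ^ 2 - 4 * ‖w z‖ ^ 2 ∧
      (m * (p z - 2 * inner ℝ (w z) J₀) = p z ^ 2 - 4 * ‖w z‖ ^ 2 →
        p z + 2 * inner ℝ (w z) J₀ = m) := by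
  have hmin₀ := hmin.curry_nhds.self_of_nhds
  obtain ⟨κ, hκ, hwκ⟩ := exists_nonpos_smul_of_localMin (w := w z₀) h₁ h₂ h₁₂ hJ₀ (hwe z₀) (by
    filter_upwards [hmin₀] with I hI hI'
    linarith [hI hI'])
  have hin : (inner ℝ (w z₀) J₀ : ℝ) = κ := by
    rw [hwκ, inner_smul_left, real_inner_self_eq_norm_sq, hJ₀.1]
    simp
  have hnorm : ‖w z₀‖ = -κ := by
    rw [hwκ, norm_smul, hJ₀.1, Real.norm_eq_abs, abs_of_nonpos hκ, mul_one]
  rw [hin] at hval ⊢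
  rw [hnorm]
  refine ⟨⟨by nlinarith, by rw [← hval]; ring⟩, ?_⟩
  have hpos : 2 * ‖w z₀‖ < p z₀ := by rw [hnorm]; linarith
  have hp₀ : p z₀ ≠ 0 := by linarith [norm_nonneg (w z₀)]
  have hpos' : ∀ᶠ z in 𝓝 z₀, 2 * ‖w z‖ < p z :=
    (continuousAt_const.mul hw.norm).eventually_lt hp hpos
  have hqn : ∀ z, 2 * ‖w z‖ < p z → ‖(2 / p z) • w z‖ < 1 := by
    intro z hz
    have : 0 < p z := by linarith [norm_nonneg (w z)]
    rw [norm_smul, Real.norm_eq_abs, abs_of_pos (by positivity), div_mul_eq_mul_div,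
      div_lt_one this]
    exact hz
  have hq₀ : (2 / p z₀) • w z₀ = (2 / p z₀ * κ) • J₀ := by rw [hwκ, smul_smul]
  -- At `z₀` the axis of the boost is `J₀`, since `w z₀ = κ • J₀`.
  have hT : Filter.Tendsto (fun z => antipodalBoost ((2 / p z) • w z) (-J₀)) (𝓝 z₀) (𝓝 J₀) := by
    have hc : ContinuousAt (fun z => (2 / p z) • w z) z₀ :=
      (continuousAt_const.div hp hp₀).smul hw
    have := ContinuousAt.comp (f := fun z => (2 / p z) • w z)
      (g := fun q => antipodalBoost q (-J₀)) (x := z₀)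
      (continuousAt_antipodalBoost (hqn z₀ hpos) (by rw [norm_neg, hJ₀.1])) hc
    have hT₀ : antipodalBoost ((2 / p z₀) • w z₀) (-J₀) = J₀ := by
      have := hqn z₀ hpos
      rw [hq₀] at this ⊢
      exact antipodalBoost_smul_neg hJ₀.1 this
    have h' := this.tendsto
    simp only [Function.comp_def, hT₀] at h'
    exact h'
  have hpair : Filter.Tendsto (fun z => (z, antipodalBoost ((2 / p z) • w z) (-J₀))) (𝓝 z₀)
      (𝓝 (z₀, J₀)) := Filter.tendsto_id.prodMk_nhds hT
  -- The lower bound is needed at `(z, T z)` and also around it: the latter makes `T z` a local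
  -- minimum on the sphere in the case of equality.
  filter_upwards [hpos', hpair.eventually hmin, hpair.eventually hmin.eventually_nhds]
    with z hz hz₁ hz₂
  have hpz : 0 < p z := by linarith [norm_nonneg (w z)]
  have hTmem := antipodalBoost_mem (e := e) (hqn z hz)
    (by rw [inner_smul_left, hwe, mul_zero]) (neg_mem_orthogonalSphere hJ₀)
  have hTmul := one_add_inner_antipodalBoost_mul (J := -J₀) (hqn z hz) (by rw [norm_neg, hJ₀.1])
  set T := antipodalBoost ((2 / p z) • w z) (-J₀)
  -- The complementarity identity for `q = 2w / p`, multiplied by `p²`.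
  have hmul : (p z + 2 * inner ℝ (w z) T) * (p z - 2 * inner ℝ (w z) J₀) =
      p z ^ 2 - 4 * ‖w z‖ ^ 2 := by
    rw [inner_smul_left, inner_smul_left, inner_neg_right, norm_smul, mul_pow, Real.norm_eq_abs,
      sq_abs] at hTmul
    simp only [conj_trivial] at hTmul
    field_simp at hTmul
    linear_combination hTmul
  have hJpos : 0 < p z - 2 * inner ℝ (w z) J₀ := by
    have := real_inner_le_norm (w z) J₀
    rw [hJ₀.1, mul_one] at this
    linarith
  have hTm := hz₁ hTmem
  refine ⟨by rw [← hmul]; exact mul_le_mul_of_nonneg_right hTm hJpos.le, fun heq => ?_⟩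
  have hval' : p z + 2 * inner ℝ (w z) T = m :=
    mul_right_cancel₀ hJpos.ne' (hmul.trans heq.symm)
  obtain ⟨μ, hμ, hwμ⟩ := exists_nonpos_smul_of_localMin (w := w z) h₁ h₂ h₁₂ hTmem (hwe z) (by
    filter_upwards [(Continuous.prodMk_right z).continuousAt.eventually hz₂] with I hI hI'
    have := hI hI'
    linarith)
  have hin' : (inner ℝ (w z) T : ℝ) = μ := by
    rw [hwμ, inner_smul_left, real_inner_self_eq_norm_sq, hTmem.1]
    simp
  have hnorm' : ‖w z‖ = -μ := by
    rw [hwμ, norm_smul, hTmem.1, Real.norm_eq_abs, abs_of_nonpos hμ, mul_one]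
  rw [hin'] at hval' hmul
  rw [hnorm'] at hmul
  -- Both sides multiplied by `p + 2μ = m` give `p² - 4μ²`; hence `⟨w, J₀⟩ = μ = ⟨w, T⟩`, and the
  -- values at `J₀` and `T` agree.
  have : p z - 2 * inner ℝ (w z) J₀ = p z - 2 * μ := by
    refine mul_left_cancel₀ (hval'.trans_ne hm.ne') (hmul.trans ?_)
    ring
  linarith

end Sphere

theorem Complex.eq_I_or_eq_neg_I {j : ℂ} (h : j * -j = 1) : j = Complex.I ∨ j = -Complex.I := by
  have : (j - Complex.I) * (j + Complex.I) = 0 := by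
    linear_combination -h - Complex.I_mul_I
  exact (mul_eq_zero.1 this).imp sub_eq_zero.1 eq_neg_of_add_eq_zero_left

/-! ### The modulus of `F₁ + J F₂` in the three algebras. -/

namespace BaseAlgebra

variable {A : BaseAlgebra}

/-- Left multiplication by `a` as a real linear map. -/
noncomputable def mulLeftLinear (a : A) : A →ₗ[ℝ] A where
  toFun x := a * x
  map_add' := mul_add_distrib a
  map_smul' r x := mul_smul_eq r a x

theorem norm_star_eq (x : A) : ‖star x‖ = ‖x‖ := by
  refine (sq_eq_sq₀ (norm_nonneg _) (norm_nonneg _)).1 ?_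
  rw [star_eq, norm_sub_sq_real, norm_smul, mul_pow, Real.norm_eq_abs, sq_abs, norm_one_eq,
    inner_smul_left, real_inner_comm]
  simp only [conj_trivial]
  ring

theorem norm_mul_eq (x y : A) : ‖x * y‖ = ‖x‖ * ‖y‖ := by
  refine (sq_eq_sq₀ (norm_nonneg _) (by positivity)).1 ?_
  rw [← real_inner_self_eq_norm_sq, inner_mul_right_eq, mul_mul_star_eq, inner_smul_left,
    real_inner_self_eq_norm_sq]
  simp only [conj_trivial]
  ring

theorem mul_star_eq (x : A) : x * star x = ‖x‖ ^ 2 • (1 : A) := by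
  have := mul_mul_star_eq 1 x
  rwa [one_mul_eq] at this

theorem one_ne_zero_eq : (1 : A) ≠ 0 := by
  rw [← norm_ne_zero_iff, norm_one_eq]
  exact one_ne_zero

theorem imUnits_eq : imUnits A = orthogonalSphere (1 : A) := by
  ext J
  have h₁ : J + star J = (2 * inner ℝ J 1 : ℝ) • (1 : A) := by rw [star_eq]; abel
  have h₂ : J * star J = 1 ↔ ‖J‖ = 1 := by
    rw [mul_star_eq, ← pow_eq_one_iff_of_nonneg (norm_nonneg J) two_ne_zero]
    constructor
    · intro h
      refine smul_left_injective ℝ (one_ne_zero_eq (A := A)) ?_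
      simpa using h
    · intro h
      rw [h, one_smul]
  constructor
  · rintro ⟨h, h'⟩
    refine ⟨h₂.1 h', ?_⟩
    rw [h₁] at h
    simpa using (smul_eq_zero.1 h).resolve_right one_ne_zero_eq
  · rintro ⟨h, h'⟩
    refine ⟨?_, h₂.2 h⟩
    rw [h₁, h', mul_zero, zero_smul]

theorem neg_mul_eq (x y : A) : -x * y = -(x * y) := by
  have := smul_mul_eq (-1) x y
  simpa using this

theorem neg_mem_imUnits {J : A} (hJ : J ∈ imUnits A) : -J ∈ imUnits A := by
  rw [imUnits_eq] at hJ ⊢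
  exact neg_mem_orthogonalSphere hJ

theorem star_of_mem_imUnits {J : A} (hJ : J ∈ imUnits A) : star J = -J :=
  eq_neg_of_add_eq_zero_right hJ.1

theorem norm_of_mem_imUnits {J : A} (hJ : J ∈ imUnits A) : ‖J‖ = 1 := by
  rw [imUnits_eq] at hJ
  exact hJ.1

theorem mulLeftLinear_mulLeftLinear {J : A} (hJ : J ∈ imUnits A) (x : A) :
    mulLeftLinear J (mulLeftLinear J x) = -x := by
  have := star_mul_mul_eq J x
  rw [star_of_mem_imUnits hJ, neg_mul_eq, norm_of_mem_imUnits hJ, one_pow, one_smul] at this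
  exact neg_eq_iff_eq_neg.1 this

theorem norm_mulLeftLinear {J : A} (hJ : J ∈ imUnits A) (x : A) : ‖mulLeftLinear J x‖ = ‖x‖ :=
  (norm_mul_eq J x).trans (by rw [norm_of_mem_imUnits hJ, one_mul])

theorem inner_mulLeftLinear {J : A} (hJ : J ∈ imUnits A) (x : A) :
    inner ℝ x (mulLeftLinear J x) = (0 : ℝ) := by
  refine (inner_mul_right_eq x J x).trans ?_
  rw [mul_star_eq, inner_smul_left, real_inner_comm]
  rw [imUnits_eq] at hJ
  rw [hJ.2, mul_zero]

theorem imPart_eq (x : A) : imPart x = x - (inner ℝ x 1 : ℝ) • (1 : A) := by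
  rw [imPart, star_eq]
  module

theorem inner_imPart_one (x : A) : inner ℝ (imPart x) (1 : A) = (0 : ℝ) := by
  rw [imPart_eq, inner_sub_left, inner_smul_left, real_inner_self_eq_norm_sq, norm_one_eq]
  simp

theorem inner_mul_star_one (x y : A) : inner ℝ (x * star y) (1 : A) = (inner ℝ x y : ℝ) := by
  rw [← inner_mul_right_eq, one_mul_eq]

theorem inner_imPart_mul_star {J : A} (hJ : J ∈ imUnits A) (x y : A) :
    inner ℝ (imPart (x * star y)) J = (inner ℝ x (J * y) : ℝ) := by
  rw [imUnits_eq] at hJ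
  rw [imPart_eq, inner_sub_left, inner_smul_left, real_inner_comm J 1, hJ.2, inner_mul_right_eq]
  simp

theorem norm_sq_imPart_mul_star (x y : A) :
    ‖imPart (x * star y)‖ ^ 2 = ‖x‖ ^ 2 * ‖y‖ ^ 2 - (inner ℝ x y : ℝ) ^ 2 := by
  rw [imPart_eq, norm_sub_sq_real, inner_smul_right, inner_mul_star_one, norm_smul, norm_one_eq,
    norm_mul_eq, norm_star_eq, Real.norm_eq_abs, mul_pow, mul_pow, sq_abs]
  ring

theorem norm_sq_add_mul {J : A} (hJ : J ∈ imUnits A) (x y : A) :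
    ‖x + J * y‖ ^ 2 =
      ‖x‖ ^ 2 + ‖y‖ ^ 2 + 2 * inner ℝ (imPart (x * star y)) J := by
  rw [norm_add_sq_real, inner_imPart_mul_star hJ, norm_mul_eq, norm_of_mem_imUnits hJ]
  ring

/-- By `norm_sq_imPart_mul_star` this is `(a - b)² + 4c² = (a + b)² - 4(ab - c²)`. The right side is
the product of the extreme values of `|x + J y|²` when the sphere of units has positive dimension.
-/
theorem norm_sq_normal (x y : A) :
    ‖(⟨‖x‖ ^ 2 - ‖y‖ ^ 2, 2 * inner ℝ x y⟩ : ℂ)‖ ^ 2 =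
      (‖x‖ ^ 2 + ‖y‖ ^ 2) ^ 2 - 4 * ‖imPart (x * star y)‖ ^ 2 := by
  rw [Complex.sq_norm, Complex.normSq_apply, norm_sq_imPart_mul_star]
  ring

/-- Multiplication as a continuous bilinear map. -/
noncomputable def mulBilinear (A : BaseAlgebra) : A →L[ℝ] A →L[ℝ] A :=
  LinearMap.mkContinuous₂
    (LinearMap.mk₂ ℝ (fun x y : A => x * y) add_mul_distrib smul_mul_eq mul_add_distrib
      mul_smul_eq) 1
    (fun x y => by
      rw [one_mul]
      exact (norm_mul_eq x y).le)

theorem continuous_star_eq : Continuous (fun x : A => star x) := by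
  simp_rw [star_eq]
  fun_prop

theorem continuous_imPart : Continuous (imPart : A → A) := by
  simp_rw [funext imPart_eq]
  fun_prop

theorem continuousAt_imPart_mul_star {F₁ F₂ : ℂ → A} {z : ℂ} (h₁ : ContinuousAt F₁ z)
    (h₂ : ContinuousAt F₂ z) : ContinuousAt (fun z => imPart (F₁ z * star (F₂ z))) z := by
  have h := ((mulBilinear A).continuous.continuousAt.comp h₁).clm_apply
    (continuous_star_eq.continuousAt.comp h₂)
  exact continuous_imPart.continuousAt.comp h

theorem hasFDerivAt_add_mul {F₁ F₂ : ℂ → A} {z : ℂ} (J : A) (h₁ : DifferentiableAt ℝ F₁ z)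
    (h₂ : DifferentiableAt ℝ F₂ z) :
    HasFDerivAt (fun z => F₁ z + J * F₂ z)
      (fderiv ℝ F₁ z + (mulBilinear A J).comp (fderiv ℝ F₂ z)) z :=
  h₁.hasFDerivAt.add ((mulBilinear A J).hasFDerivAt.comp z h₂.hasFDerivAt)

/-- The Cauchy–Riemann equations for the stem function become those for the complex structure `J`,
because `J (a + J b) = J a - b` even without associativity. -/
theorem fderiv_add_mul_I {F₁ F₂ : ℂ → A} {z : ℂ} {J : A} (hJ : J ∈ imUnits A)
    (h₁ : DifferentiableAt ℝ F₁ z) (h₂ : DifferentiableAt ℝ F₂ z)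
    (hCR : fderiv ℝ F₁ z 1 = fderiv ℝ F₂ z Complex.I)
    (hCR' : fderiv ℝ F₁ z Complex.I = -fderiv ℝ F₂ z 1) :
    fderiv ℝ (fun z => F₁ z + J * F₂ z) z Complex.I =
      mulLeftLinear J (fderiv ℝ (fun z => F₁ z + J * F₂ z) z 1) := by
  rw [(hasFDerivAt_add_mul J h₁ h₂).fderiv]
  change fderiv ℝ F₁ z Complex.I + mulLeftLinear J (fderiv ℝ F₂ z Complex.I) =
    mulLeftLinear J (fderiv ℝ F₁ z 1 + mulLeftLinear J (fderiv ℝ F₂ z 1))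
  rw [map_add, mulLeftLinear_mulLeftLinear hJ, hCR, hCR']
  abel

/-- If the modulus of `F₁ + J F₂` has a nonzero local minimum at `(z₀, J₀)`, jointly in `z` and in
the imaginary unit `J`, then the modulus of `F₁ + J₀ F₂` is constant near `z₀`. -/
theorem eventually_norm_eq_of_localMin (hA : A ≠ complex) {F₁ F₂ : ℂ → A} {z₀ : ℂ} {J₀ : A}
    (hJ₀ : J₀ ∈ imUnits A)
    (h₁ : ∀ᶠ z in 𝓝 z₀, DifferentiableAt ℝ F₁ z) (h₂ : ∀ᶠ z in 𝓝 z₀, DifferentiableAt ℝ F₂ z)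
    (hCR : ∀ᶠ z in 𝓝 z₀, fderiv ℝ F₁ z 1 = fderiv ℝ F₂ z Complex.I ∧
      fderiv ℝ F₁ z Complex.I = -fderiv ℝ F₂ z 1)
    (hne : F₁ z₀ + J₀ * F₂ z₀ ≠ 0)
    (hmin : ∀ᶠ x in 𝓝 (z₀, J₀), x.2 ∈ imUnits A →
      ‖F₁ z₀ + J₀ * F₂ z₀‖ ≤ ‖F₁ x.1 + x.2 * F₂ x.1‖) :
    ∀ᶠ z in 𝓝 z₀, ‖F₁ z + J₀ * F₂ z‖ = ‖F₁ z₀ + J₀ * F₂ z₀‖ := by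
  obtain ⟨e₁, e₂, n₁, n₂, i₁, i₂, i₁₂⟩ := exists_orthonormal_imaginary hA
  have hJn := neg_mem_imUnits hJ₀
  have hc₁ := h₁.self_of_nhds.continuousAt
  have hc₂ := h₂.self_of_nhds.continuousAt
  have hneg : ∀ z, ‖F₁ z + -J₀ * F₂ z‖ ^ 2 = ‖F₁ z‖ ^ 2 + ‖F₂ z‖ ^ 2 -
      2 * inner ℝ (imPart (F₁ z * star (F₂ z))) J₀ := by
    intro z
    rw [norm_sq_add_mul hJn, inner_neg_right]
    ring
  obtain ⟨⟨hpos, heq⟩, hev⟩ := eventually_affine_family (z₀ := z₀) (J₀ := J₀)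
    (m := ‖F₁ z₀ + J₀ * F₂ z₀‖ ^ 2) (p := fun z => ‖F₁ z‖ ^ 2 + ‖F₂ z‖ ^ 2)
    (w := fun z => imPart (F₁ z * star (F₂ z))) ⟨n₁, i₁⟩ ⟨n₂, i₂⟩ i₁₂ (imUnits_eq ▸ hJ₀)
    (by have := norm_pos_iff.2 hne; positivity)
    ((hc₁.norm.pow 2).add (hc₂.norm.pow 2)) (continuousAt_imPart_mul_star hc₁ hc₂)
    (fun z => inner_imPart_one _) (norm_sq_add_mul hJ₀ _ _).symm (by
      filter_upwards [hmin] with x hx hxJ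
      rw [← imUnits_eq] at hxJ
      rw [← norm_sq_add_mul hxJ]
      exact pow_le_pow_left₀ (norm_nonneg _) (hx hxJ) 2)
  simp only [← hneg, ← norm_sq_normal] at hpos heq hev
  set n : ℂ → ℂ := fun z => ⟨‖F₁ z‖ ^ 2 - ‖F₂ z‖ ^ 2, 2 * inner ℝ (F₁ z) (F₂ z)⟩ with hn
  set m : ℝ := ‖F₁ z₀ + J₀ * F₂ z₀‖ with hm
  have hm0 : 0 < m := norm_pos_iff.2 hne
  have hnd : ∀ᶠ z in 𝓝 z₀, DifferentiableAt ℂ n z := by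
    filter_upwards [h₁, h₂, hCR] with z hz₁ hz₂ hz
    exact differentiableAt_normal_of_cauchyRiemann hz₁ hz₂ hz.1 hz.2
  have hn0 : n z₀ ≠ 0 := by
    intro h
    have hpos' : 0 < ‖n z₀‖ ^ 2 := hpos
    rw [h, norm_zero] at hpos'
    norm_num at hpos'
  have hn0' : ∀ᶠ z in 𝓝 z₀, n z ≠ 0 := hnd.self_of_nhds.continuousAt.eventually_ne hn0
  -- Here `heq` is the case of equality at `z₀`, where the complementary unit is `J₀` itself.
  have hval₀ : ‖(n z₀)⁻¹‖ * ‖F₁ z₀ + -J₀ * F₂ z₀‖ = m⁻¹ := by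
    have : m * ‖F₁ z₀ + -J₀ * F₂ z₀‖ = ‖n z₀‖ := by
      refine (sq_eq_sq₀ (by positivity) (norm_nonneg _)).1 ?_
      rw [mul_pow]
      exact heq
    rw [norm_inv, ← this]
    have h' : ‖F₁ z₀ + -J₀ * F₂ z₀‖ ≠ 0 := by
      intro h
      rw [h, mul_zero] at this
      exact hn0 (norm_eq_zero.1 this.symm)
    field_simp
  have hmax : IsLocalMax (fun z => ‖(n z)⁻¹‖ * ‖F₁ z + -J₀ * F₂ z‖) z₀ := by
    filter_upwards [hev, hn0'] with z hz hz0
    rw [hval₀, norm_inv, inv_mul_le_iff₀ (norm_pos_iff.2 hz0), ← div_eq_mul_inv,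
      le_div_iff₀ hm0, mul_comm]
    refine (sq_le_sq₀ (by positivity) (norm_nonneg _)).1 ?_
    rw [mul_pow]
    exact hz.1
  -- `F₁ - J₀ F₂` is holomorphic for the structure `-J₀`, and the scalar `n⁻¹` acts through that
  -- same structure.
  have hconst := eventually_norm_mul_norm_eq_of_isLocalMax (mulLeftLinear_mulLeftLinear hJn)
    (norm_mulLeftLinear hJn) (inner_mulLeftLinear hJn) (n := fun z => (n z)⁻¹)
    (h := fun z => F₁ z + -J₀ * F₂ z) (z₀ := z₀)
    (by
      filter_upwards [h₁, h₂] with z hz₁ hz₂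
      exact (hasFDerivAt_add_mul _ hz₁ hz₂).differentiableAt)
    (by
      filter_upwards [h₁, h₂, hCR] with z hz₁ hz₂ hz
      exact fderiv_add_mul_I hJn hz₁ hz₂ hz.1 hz.2)
    (by filter_upwards [hnd, hn0'] with z hz hz0 using hz.inv hz0) hmax
  filter_upwards [hconst, hev, hn0'] with z hz hz' hz0
  refine (sq_eq_sq₀ (norm_nonneg _) hm0.le).1 ((norm_sq_add_mul hJ₀ _ _).trans (hz'.2 ?_))
  rw [hval₀, norm_inv, inv_mul_eq_iff_eq_mul₀ (norm_ne_zero_iff.2 hz0), ← div_eq_mul_inv,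
    eq_div_iff hm0.ne'] at hz
  rw [← mul_pow, mul_comm m, hz]

/-- In `ℂ`, a nonzero local minimum of the modulus of `F₁ + J₀ F₂` forces this function to be
locally constant. -/
theorem eventually_eq_of_localMin_complex {F₁ F₂ : ℂ → complex} {z₀ : ℂ} {J₀ : complex}
    (hJ₀ : J₀ ∈ imUnits complex)
    (h₁ : ∀ᶠ z in 𝓝 z₀, DifferentiableAt ℝ F₁ z) (h₂ : ∀ᶠ z in 𝓝 z₀, DifferentiableAt ℝ F₂ z)
    (hCR : ∀ᶠ z in 𝓝 z₀, fderiv ℝ F₁ z 1 = fderiv ℝ F₂ z Complex.I ∧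
      fderiv ℝ F₁ z Complex.I = -fderiv ℝ F₂ z 1)
    (hne : F₁ z₀ + J₀ * F₂ z₀ ≠ 0)
    (hmin : IsLocalMin (fun z => ‖F₁ z + J₀ * F₂ z‖) z₀) :
    ∀ᶠ z in 𝓝 z₀, F₁ z + J₀ * F₂ z = F₁ z₀ + J₀ * F₂ z₀ := by
  have hJI := Complex.eq_I_or_eq_neg_I (j := J₀) (by
    have h := hJ₀.2
    rw [star_of_mem_imUnits hJ₀] at h
    exact h)
  refine Complex.eventually_eq_of_isLocalMin_norm_of_unit
    (h := fun z => F₁ z + J₀ * F₂ z) hJI ?_ ?_ hmin hne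
  · filter_upwards [h₁, h₂] with z hz₁ hz₂
    exact (hasFDerivAt_add_mul _ hz₁ hz₂).differentiableAt
  · filter_upwards [h₁, h₂, hCR] with z hz₁ hz₂ hz
    exact fderiv_add_mul_I hJ₀ hz₁ hz₂ hz.1 hz.2

/-- If the modulus of `F₁ + J F₂` has a nonzero local minimum at `(z₀, J₀)`, jointly in `z` and in
the imaginary unit `J`, then `F₁ + J₀ F₂` is constant near `z₀`. -/
theorem eventually_eq_of_localMin : ∀ {A : BaseAlgebra} {F₁ F₂ : ℂ → A} {z₀ : ℂ} {J₀ : A},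
    J₀ ∈ imUnits A →
    (∀ᶠ z in 𝓝 z₀, DifferentiableAt ℝ F₁ z) → (∀ᶠ z in 𝓝 z₀, DifferentiableAt ℝ F₂ z) →
    (∀ᶠ z in 𝓝 z₀, fderiv ℝ F₁ z 1 = fderiv ℝ F₂ z Complex.I ∧
      fderiv ℝ F₁ z Complex.I = -fderiv ℝ F₂ z 1) →
    F₁ z₀ + J₀ * F₂ z₀ ≠ 0 →
    (∀ᶠ x in 𝓝 (z₀, J₀), x.2 ∈ imUnits A →
      ‖F₁ z₀ + J₀ * F₂ z₀‖ ≤ ‖F₁ x.1 + x.2 * F₂ x.1‖) →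
    ∀ᶠ z in 𝓝 z₀, F₁ z + J₀ * F₂ z = F₁ z₀ + J₀ * F₂ z₀ := by
  intro A F₁ F₂ z₀ J₀ hJ₀ h₁ h₂ hCR hne hmin
  by_cases hA : A = complex
  · subst hA
    refine eventually_eq_of_localMin_complex hJ₀ h₁ h₂ hCR hne ?_
    have := (Continuous.prodMk_left J₀).continuousAt.eventually hmin
    filter_upwards [this] with z hz using hz hJ₀
  · have hnorm := eventually_norm_eq_of_localMin hA hJ₀ h₁ h₂ hCR hne hmin
    -- A locally constant modulus has a local maximum at `z₀`.
    refine eventually_eq_of_isLocalMax_norm_of_complexStructure (mulLeftLinear_mulLeftLinear hJ₀)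
      (norm_mulLeftLinear hJ₀) (inner_mulLeftLinear hJ₀) (h := fun z => F₁ z + J₀ * F₂ z) ?_ ?_
      (hnorm.mono fun z hz => hz.le)
    · filter_upwards [h₁, h₂] with z hz₁ hz₂
      exact (hasFDerivAt_add_mul _ hz₁ hz₂).differentiableAt
    · filter_upwards [h₁, h₂, hCR] with z hz₁ hz₂ hz
      exact fderiv_add_mul_I hJ₀ hz₁ hz₂ hz.1 hz.2

end BaseAlgebra

/-! ### Circularizations, components and the minimum modulus principle. -/

namespace SliceFunction

open BaseAlgebra

variable {A : BaseAlgebra}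

theorem continuous_point : Continuous (fun x : ℂ × A => point x.1.re x.1.im x.2) := by
  unfold point
  fun_prop

theorem point_injective {α β a b : ℝ} {I J : A} (hI : I ∈ imUnits A) (hJ : J ∈ imUnits A)
    (h : point α β I = point a b J) : α = a ∧ β • I = b • J := by
  rw [imUnits_eq] at hI hJ
  have key : ∀ (r s : ℝ) {K : A}, K ∈ orthogonalSphere (1 : A) →
      inner ℝ (point r s K) (1 : A) = r := by
    intro r s K hK
    rw [point, inner_add_left, inner_smul_left, inner_smul_left, hK.2, real_inner_self_eq_norm_sq,
      norm_one_eq]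
    simp
  have hα : α = a := by rw [← key α β hI, h, key a b hJ]
  subst hα
  exact ⟨rfl, add_left_cancel h⟩

theorem mem_of_point_mem {D : Set ℂ} (hD : ConjInvariant D) {a b : ℝ} {J : A}
    (hJ : J ∈ imUnits A) (h : point a b J ∈ circularization A D) : (⟨a, b⟩ : ℂ) ∈ D := by
  obtain ⟨α, β, I, hI, he, hz⟩ := h
  obtain ⟨rfl, h'⟩ := point_injective hJ hI he
  have hab : |b| = |β| := by
    have := congrArg norm h'
    rwa [norm_smul, norm_smul, norm_of_mem_imUnits hI, norm_of_mem_imUnits hJ, mul_one,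
      mul_one] at this
  rcases abs_eq_abs.1 hab with rfl | rfl
  · exact hz
  · exact hD _ hz

theorem point_neg (a b : ℝ) (J : A) : point a b (-J) = point a (-b) J := by
  rw [point, point, smul_neg, neg_smul]

end SliceFunction

/-- A connected set of complex numbers that avoids the real line lies in a half-plane. -/
theorem IsPreconnected.im_mul_im_pos {K : Set ℂ} (hK : IsPreconnected K)
    (hr : ∀ r : ℝ, (r : ℂ) ∉ K) {z w : ℂ} (hz : z ∈ K) (hw : w ∈ K) : 0 < z.im * w.im := by
  have hne : ∀ v ∈ K, v.im ≠ 0 := fun v hv h0 => hr v.re (by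
    convert hv using 1
    apply Complex.ext <;> simp [h0])
  by_contra! hle
  have him := hK.image _ Complex.continuous_im.continuousOn
  have hmem : (0 : ℝ) ∈ Complex.im '' K := by
    rcases le_total z.im w.im with h | h
    · exact him.Icc_subset ⟨z, hz, rfl⟩ ⟨w, hw, rfl⟩ ⟨by nlinarith, by nlinarith⟩
    · exact him.Icc_subset ⟨w, hw, rfl⟩ ⟨z, hz, rfl⟩ ⟨by nlinarith, by nlinarith⟩
  obtain ⟨v, hv, h0⟩ := hmem
  exact hne v hv h0

/-- In the base of a product domain, points on the same side of the real line lie in the same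
component. -/
theorem SliceFunction.IsProductDomain.mem_component {D : Set ℂ}
    (hD : IsProductDomain D) {z w : ℂ} (hz : z ∈ D) (hw : w ∈ D) (h : 0 < z.im * w.im) :
    w ∈ connectedComponentIn D z := by
  obtain ⟨-, hr, D₁, D₂, -, hcomp, hconj⟩ := hD
  have hsub (v : ℂ) (r : ℝ) : (r : ℂ) ∉ connectedComponentIn D v := fun hv =>
    hr r (connectedComponentIn_subset D v hv)
  have hzm : connectedComponentIn D z ∈ ({D₁, D₂} : Set (Set ℂ)) := hcomp ▸ ⟨z, hz, rfl⟩
  have hwm : connectedComponentIn D w ∈ ({D₁, D₂} : Set (Set ℂ)) := hcomp ▸ ⟨w, hw, rfl⟩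
  have hzz := mem_connectedComponentIn hz
  have hww := mem_connectedComponentIn hw
  suffices connectedComponentIn D w = connectedComponentIn D z by rwa [← this]
  -- Distinct components would be exchanged by conjugation, which changes the side of the real line.
  have hcontra : ∀ {u v : ℂ}, u ∈ D → v ∈ D → 0 < u.im * v.im →
      (fun z : ℂ => conj z) '' connectedComponentIn D u = connectedComponentIn D v → False := by
    intro u v hu hv huv he
    have hm : conj u ∈ connectedComponentIn D v := he ▸ ⟨u, mem_connectedComponentIn hu, rfl⟩
    have := isPreconnected_connectedComponentIn.im_mul_im_pos (hsub v) hm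
      (mem_connectedComponentIn hv)
    rw [Complex.conj_im] at this
    linarith
  rcases hzm with hz' | hz' <;> rcases hwm with hw' | hw'
  · exact hw'.trans hz'.symm
  · exact (hcontra hz hw h (by rw [hz', hconj]; exact hw'.symm)).elim
  · exact (hcontra hw hz (by rwa [mul_comm]) (by rw [hw', hconj]; exact hz'.symm)).elim
  · exact hw'.trans (Eq.symm hz')

/-- Minimum modulus principle. The proof does not use `hboundary`: near a local minimum point the
complementary imaginary unit of `eventually_affine_family` depends continuously on the base point,
also where the spherical derivative vanishes. -/
theorem mainTheorem2 (A : BaseAlgebra) (D : Set ℂ) (hD : ConjInvariant D) (f : A → A)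
    (hf : IsSliceRegular D f) (x₀ : A) (hx₀ : x₀ ∈ circularization A D) (hfx₀ : f x₀ ≠ 0)
    (hmin : IsLocalMinOn (fun x => ‖f x‖) (circularization A D) x₀)
    (hboundary : x₀ ∈ frontier (sphDerivZeros D f) →
      (∃ C : Set A, IsCircular C ∧ C ∈ 𝓝 x₀ ∧ C ⊆ circularization A D ∧
        IsMinOn (fun x => ‖f x‖) C x₀) ∨
      (∃ w₀ ∈ sphereThrough x₀, ∃ H : Set A, IsOpen H ∧ w₀ ∈ H ∧ H ⊆ circularization A D ∧
        ∃ T : A → A, ContinuousOn T (transformDomain D f ∪ H) ∧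
          Set.EqOn T (transform f) (transformDomain D f) ∧ T w₀ = x₀)) :
    (IsSliceDomain D → ∃ c : A, ∀ x ∈ circularization A D, f x = c) ∧
    (IsProductDomain D → ∃ J ∈ imUnits A,
      ∀ x ∈ circularization A D ∩ halfPlane J, f x = f x₀) := by
  obtain ⟨hDo, F₁, F₂, hF, hF₁, hF₂, hCR⟩ := hf
  obtain ⟨α, β, J₀, hJ₀, rfl, hz₀⟩ := hx₀
  set z₀ : ℂ := ⟨α, β⟩ with hz₀_def
  have hfz : ∀ z ∈ D, ∀ J ∈ imUnits A, f (point z.re z.im J) = F₁ z + J * F₂ z :=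
    fun z hz J hJ => hF.induces z.re z.im hz J hJ
  have hf₀ : f (point α β J₀) = F₁ z₀ + J₀ * F₂ z₀ := hfz z₀ hz₀ J₀ hJ₀
  have hd₁ : ∀ z ∈ D, DifferentiableAt ℝ F₁ z := fun z hz =>
    (hF₁.contDiffAt (hDo.mem_nhds hz)).differentiableAt one_ne_zero
  have hd₂ : ∀ z ∈ D, DifferentiableAt ℝ F₂ z := fun z hz =>
    (hF₂.contDiffAt (hDo.mem_nhds hz)).differentiableAt one_ne_zero
  have hDn : ∀ᶠ z in 𝓝 z₀, z ∈ D := hDo.mem_nhds hz₀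
  have hloc : ∀ᶠ z in 𝓝 z₀, F₁ z + J₀ * F₂ z = F₁ z₀ + J₀ * F₂ z₀ := by
    refine BaseAlgebra.eventually_eq_of_localMin hJ₀ (hDn.mono hd₁) (hDn.mono hd₂)
      (hDn.mono hCR) (hf₀ ▸ hfx₀) ?_
    -- A local minimum of `|f|` at `x₀` pulls back along `(z, J) ↦ point z.re z.im J` to a minimum
    -- jointly in `z` and `J`.
    have hpt := continuous_point.continuousAt (x := (z₀, J₀)) |>.eventually
      (eventually_nhdsWithin_iff.1 hmin)
    filter_upwards [hpt, (continuous_fst.continuousAt (x := (z₀, J₀))).eventually hDn]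
      with x hx hxD hxJ
    have := hx ⟨x.1.re, x.1.im, x.2, hxJ, rfl, hxD⟩
    rwa [hfz x.1 hxD x.2 hxJ, hf₀] at this
  have hK : ∀ z ∈ connectedComponentIn D z₀, F₁ z + J₀ * F₂ z = F₁ z₀ + J₀ * F₂ z₀ := by
    have hsub := connectedComponentIn_subset D z₀
    refine eqOn_const_of_eventually_eq_of_complexStructure
      (BaseAlgebra.mulLeftLinear_mulLeftLinear hJ₀) (BaseAlgebra.norm_mulLeftLinear hJ₀)
      (BaseAlgebra.inner_mulLeftLinear hJ₀) hDo.connectedComponentIn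
      isPreconnected_connectedComponentIn (mem_connectedComponentIn hz₀) ?_ ?_ hloc
    · exact fun z hz =>
        (BaseAlgebra.hasFDerivAt_add_mul _ (hd₁ z (hsub hz)) (hd₂ z (hsub hz))).differentiableAt
    · exact fun z hz => BaseAlgebra.fderiv_add_mul_I hJ₀ (hd₁ z (hsub hz)) (hd₂ z (hsub hz))
        (hCR z (hsub hz)).1 (hCR z (hsub hz)).2
  constructor
  · rintro ⟨-, hconn, -⟩
    rw [hconn.isPreconnected.connectedComponentIn hz₀] at hK
    refine ⟨F₁ z₀ + J₀ * F₂ z₀, ?_⟩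
    rintro x ⟨a, b, J, hJ, rfl, hz⟩
    have h₁ := hK _ hz
    -- On a slice domain the component is all of `D`, so `F₁ + J₀ F₂` takes the same value at `z`
    -- and at its conjugate; parity then gives `J₀ F₂ = 0`, and `f` no longer depends on `J`.
    have h₂ := hK _ (hD _ hz)
    rw [hF.even _ hz, hF.odd _ hz] at h₂
    have hneg : J₀ * -F₂ ⟨a, b⟩ = -(J₀ * F₂ ⟨a, b⟩) :=
      map_neg (BaseAlgebra.mulLeftLinear J₀) _
    rw [hneg] at h₂
    have h₀ : J₀ * F₂ ⟨a, b⟩ = 0 := by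
      have h := add_left_cancel (h₁.trans h₂.symm)
      have h2 : (2 : ℝ) • (J₀ * F₂ ⟨a, b⟩) = 0 := by
        rw [two_smul]
        nth_rewrite 1 [h]
        exact neg_add_cancel _
      exact (smul_eq_zero.1 h2).resolve_left two_ne_zero
    have hF₂0 : F₂ ⟨a, b⟩ = 0 := by
      rw [← norm_eq_zero, ← BaseAlgebra.norm_mulLeftLinear hJ₀, norm_eq_zero]
      exact h₀
    rw [h₀, add_zero] at h₁
    have hJ0 : J * (0 : A) = 0 := map_zero (BaseAlgebra.mulLeftLinear J)
    rw [hF.induces a b hz J hJ, hF₂0, hJ0, add_zero, h₁]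
  · intro hP
    have key : ∀ a b : ℝ, 0 < β * b → point a b J₀ ∈ circularization A D →
        f (point a b J₀) = f (point α β J₀) := by
      intro a b hb hx
      have hz := mem_of_point_mem hD hJ₀ hx
      rw [hF.induces a b hz J₀ hJ₀, hf₀]
      exact hK _ (hP.mem_component hz₀ hz hb)
    have hβ : β ≠ 0 := by
      intro h
      refine hP.2.1 α ?_
      convert hz₀ using 1
      apply Complex.ext <;> simp [hz₀_def, h]
    -- The required unit is the one whose half-plane contains `x₀`: `-J₀` if `β < 0`, and `J₀` if `β
    -- > 0`.
    rcases lt_or_gt_of_ne hβ with hβ | hβ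
    · refine ⟨-J₀, BaseAlgebra.neg_mem_imUnits hJ₀, ?_⟩
      rintro x ⟨hx, a, b, hb, rfl⟩
      rw [point_neg] at hx ⊢
      exact key a (-b) (by nlinarith) hx
    · refine ⟨J₀, hJ₀, ?_⟩
      rintro x ⟨hx, a, b, hb, rfl⟩
      exact key a b (by positivity) hx
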